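/- Let $f:\mathbb{R}\to\mathbb{R}$ be continuously differentiable, with $f$ nondecreasing and $f\ge 0$ on $\mathbb{R}_+=[0,\infty)$. Let $g:[0,1]\to\mathbb{R}_+$ be bounded, nondecreasing on $[0,1/2]$, with $g(t)=g(1-t)$ for all $t\in[0,1/2]$. Equip the Sobolev space $H_0^1(0,1)$ (whose elements are identified with their continuous representatives on $[0,1]$) with $(u,v)_{H_0^1}=\int_0^1u'v'\,dt$ and $|u|_{H_0^1}=(u,u)_{H_0^1}^{1/2}$. Put $\phi(t)=t(1-2t)$ and $$K=\{u\in H_0^1(0,1): u\text{ is nondecreasing on }[0,1/2],\ u(t)=u(1-t)\text{ and }u(t)\ge\phi(t)|u|_{H_0^1}\text{ for all }t\in[0,1/2]\}.$$ Let $0<r<R<\infty$, $\beta\in(0,1/4)$, and $$\tilde A=\Big(\int_0^1g^2\,dt\Big)^{1/2},\quad \tilde B=\int_0^\beta g\,dt,\quad \tilde C=\int_\beta^{1/2}g\,dt .$$ Assume (H1) $\tilde A>0$, $\tilde C>0$, $\dfrac{f(r)}{r}<\dfrac{\pi}{\tilde A}$ and $\dfrac{f(R\phi(\beta))}{R}>\dfrac{1}{2\phi(\beta)\tilde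 C}$, and at least one of the following three conditions: (H2) there is a continuous $\theta:[0,R]\to\mathbb{R}$ with $\theta>0$ on $(0,R]$ and $tf'(t)-f(t)\ge\theta(t)$ for all $t\in[0,R]$; (H3) there are constants $\mu>1$ and $\lambda>0$ such that $tf'(t)-\mu f(t)\ge0$ and $f'(t)\ge\lambda$ for all $t\in[r\phi(\beta),R]$, and $\tilde B f(r\phi(\beta))<\lambda\tilde C\big(1-\tfrac1\mu\big)r\phi(\beta)$; (H4) $g=0$ on $[0,\beta]$; $f$ is of class $C^2$ on $[r\phi(\beta),R]$ and there is $M>0$ with $f''\ge M$ there; and there is a continuous $\tilde\theta:[r\phi(\beta),R]\to(0,\infty)$ with $tf'(t)-f(t)\ge\tilde\theta(t)$ for all $t\in[r\phi(\beta),R]$. Then the Dirichlet problem $$-u''(t)=g(t)f(u(t))\ \text{ on }[0,1],\qquad u(0)=u(1)=0,$$ has a (weak) solution $u^*\in K$, that is, $(u^*,v)_{H_0^1}=\int_0^1 g(t)f(u^*(t))v(t)\,dt$ for all $v\in H_0^1(0,1)$, such that $r<|u^*|_{H_0^1}<R$. -/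

import Mathlib

open MeasureTheory Set
open scoped ContDiff

noncomputable section

namespace DirichletBVP

/-- `w` is a square integrable weak derivative of `u` on the interval `(0,1)`. -/
def HasWeakDerivL2 (u w : ℝ → ℝ) : Prop :=
  MemLp w 2 (volume.restrict (Ioo (0 : ℝ) 1)) ∧
    ∀ η : ℝ → ℝ, ContDiff ℝ ∞ η → HasCompactSupport η → tsupport η ⊆ Ioo (0 : ℝ) 1 →
      ∫ t in (0 : ℝ)..1, u t * deriv η t = -∫ t in (0 : ℝ)..1, w t * η t

/-- `u` is the continuous representative on `[0,1]` of an element of the Sobolev space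
`H₀¹(0,1)`: it has a weak derivative in `L²(0,1)` and vanishes at both end points. Only the
values of `u` on `[0,1]` matter. -/
structure MemH01 (u : ℝ → ℝ) : Prop where
  continuousOn : ContinuousOn u (Icc 0 1)
  left : u 0 = 0
  right : u 1 = 0
  weak : ∃ w, HasWeakDerivL2 u w

open Classical in
/-- The weak derivative (unique up to a null set) of `u` on `(0,1)`, if there is one in `L²`. -/
def weakDeriv (u : ℝ → ℝ) : ℝ → ℝ :=
  if h : ∃ w, HasWeakDerivL2 u w then h.choose else 0

/-- The inner product `(u,v) = ∫₀¹ u' v'` of `H₀¹(0,1)`. -/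
def innerH01 (u v : ℝ → ℝ) : ℝ := ∫ t in (0 : ℝ)..1, weakDeriv u t * weakDeriv v t

/-- The energetic norm `|u| = √(u,u)` of `H₀¹(0,1)`. -/
def normH01 (u : ℝ → ℝ) : ℝ := Real.sqrt (innerH01 u u)

/-- `u` is a (weak) solution of `-u'' = g(t) f(u)` on `[0,1]`, `u(0) = u(1) = 0`. -/
def IsSolution (f g u : ℝ → ℝ) : Prop :=
  MemH01 u ∧ ∀ v : ℝ → ℝ, MemH01 v →
    innerH01 u v = ∫ t in (0 : ℝ)..1, g t * f (u t) * v t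

/-- The function `φ(t) = t (1 - 2t)` of the Harnack inequality. -/
def phi (t : ℝ) : ℝ := t * (1 - 2 * t)

/-- The cone `K` of `H₀¹(0,1)`. -/
def coneK : Set (ℝ → ℝ) :=
  {u | MemH01 u ∧ MonotoneOn u (Icc 0 (1 / 2)) ∧
    ∀ t ∈ Icc (0 : ℝ) (1 / 2), u t = u (1 - t) ∧ phi t * normH01 u ≤ u t}

/-- `Ã = (∫₀¹ g²)^{1/2}`. -/
def constA (g : ℝ → ℝ) : ℝ := Real.sqrt (∫ t in (0 : ℝ)..1, g t ^ 2)

/-- `B̃ = ∫₀^β g`. -/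
def constB (g : ℝ → ℝ) (β : ℝ) : ℝ := ∫ t in (0 : ℝ)..β, g t

/-- `C̃ = ∫_β^{1/2} g`. -/
def constC (g : ℝ → ℝ) (β : ℝ) : ℝ := ∫ t in β..(1 / 2 : ℝ), g t

/-- Condition (H1). -/
def CondH1 (f g : ℝ → ℝ) (r R β : ℝ) : Prop :=
  0 < constA g ∧ 0 < constC g β ∧ f r / r < Real.pi / constA g ∧
    f (R * phi β) / R > 1 / (2 * phi β * constC g β)

/-- Condition (H2). -/
def CondH2 (f : ℝ → ℝ) (R : ℝ) : Prop :=
  ∃ θ : ℝ → ℝ, ContinuousOn θ (Icc 0 R) ∧ (∀ t ∈ Ioc 0 R, 0 < θ t) ∧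
    ∀ t ∈ Icc 0 R, t * deriv f t - f t ≥ θ t

/-- Condition (H3). -/
def CondH3 (f g : ℝ → ℝ) (r R β : ℝ) : Prop :=
  ∃ μ l : ℝ, 1 < μ ∧ 0 < l ∧
    (∀ t ∈ Icc (r * phi β) R, t * deriv f t - μ * f t ≥ 0 ∧ deriv f t ≥ l) ∧
    constB g β * f (r * phi β) < l * constC g β * (1 - 1 / μ) * (r * phi β)

/-- Condition (H4). The derivatives of second order at the end points of `[r φ(β), R]` are
one-sided. -/
def CondH4 (f g : ℝ → ℝ) (r R β : ℝ) : Prop :=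
  (∀ t ∈ Icc 0 β, g t = 0) ∧
    ContDiffOn ℝ 2 f (Icc (r * phi β) R) ∧
    (∃ M : ℝ, 0 < M ∧
      ∀ t ∈ Icc (r * phi β) R, iteratedDerivWithin 2 f (Icc (r * phi β) R) t ≥ M) ∧
    ∃ θ : ℝ → ℝ, ContinuousOn θ (Icc (r * phi β) R) ∧ (∀ t ∈ Icc (r * phi β) R, 0 < θ t) ∧
      ∀ t ∈ Icc (r * phi β) R, t * deriv f t - f t ≥ θ t

end DirichletBVP

end

open DirichletBVP

/-!
The solution is found by shooting from the midpoint. For `m ∈ [0, R]` let `u_m` be the function on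
`[0, 1/2]` with `-u'' = g f(u)`, `u(1/2) = m`, `u'(1/2) = 0`, where `f` is extended by constants
outside `[0, R]`. In integrated form this is a Volterra equation, so `u_m` exists and
depends continuously on `m` (`exists_shooting_family`). Reflected about `1/2`, `u_m` solves the
equation on `[0, 1]` with boundary value `c(m) = u_m(0)`, and it solves the Dirichlet problem iff
`c(m) = 0`. Let `E(m) = ∫₀¹ (u_m')²`, so that `w = u_m - c(m)` lies in `H₀¹` with `|w|² = E(m)`.

The equation gives `-w'' = g f(w + c(m))`, and both bounds of `(H1)` turn into sign information on
`c(m)`, because the energy is monotone in the right-hand side (`energy_le_energy`).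

* If `E(m) = r²` and `c(m) ≤ 0`, then `u_m ≤ w ≤ r / 2`, so `|w| ≤ f(r) |T g|`, where `T` solves
  `-v'' = h` in `H₀¹`. The sharp Wirtinger inequality (`energy_le_of_abs_le`) gives
  `|T g| ≤ Ã / π`, whence `|w| < r`, a contradiction. So `c > 0` where `E = r²`.
* If `E(m) = R²` and `c(m) ≥ 0`, then `u_m ≥ w`, and the Harnack inequality `w ≥ φ |w|`
  (`phi_mul_sqrt_energy_le`) gives `u_m ≥ R φ(β)` on `[β, 1/2]`. Then `|w| > R` by
  `mul_sq_le_energy`, a contradiction. So `c < 0` where `E = R²`.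

Since `E(0) < r²` and `E(R) ≥ R²`, the continuous function `E` crosses the band `(r², R²)` between
a point with `c > 0` and a point with `c < 0`, and `c` vanishes at some `m` within this crossing
(`exists_zero_of_crossing`). The reflection of `u_m` is the solution. It lies in the cone by the
Harnack inequality.

The Sobolev side rests on the du Bois-Reymond lemma: elements of `H₀¹(0,1)` are primitives of their
weak derivatives, so the weak form of the equation is an integration by parts
(`innerH01_primitive`).
-/

namespace DirichletBVP

/-! ### Weak derivatives and `H₀¹(0,1)` -/

/-- Integration by parts for two primitives of integrable functions. -/
theorem integral_mul_primitive_add {h w : ℝ → ℝ} {a b c d : ℝ}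
    (hh : IntervalIntegrable h volume a b) (hw : IntervalIntegrable w volume a b)
    (hc : c ∈ uIcc a b) (hd : d ∈ uIcc a b) :
    ∫ x in a..b, (h x * (∫ s in d..x, w s) + (∫ s in c..x, h s) * w x) =
      (∫ s in c..b, h s) * (∫ s in d..b, w s) - (∫ s in c..a, h s) * (∫ s in d..a, w s) := by
  have aH := hh.absolutelyContinuousOnInterval_intervalIntegral hc
  have aW := hw.absolutelyContinuousOnInterval_intervalIntegral hd
  rw [← aH.integral_deriv_mul_eq_sub aW]
  apply intervalIntegral.integral_congr_ae
  filter_upwards [hh.ae_hasDerivAt_integral, hw.ae_hasDerivAt_integral] with x h1 h2 hx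
  have hx' := uIoc_subset_uIcc hx
  rw [(h1 hx' c hc).deriv, (h2 hx' d hd).deriv]

theorem HasWeakDerivL2.intervalIntegrable {u w : ℝ → ℝ} (h : HasWeakDerivL2 u w) :
    IntervalIntegrable w volume 0 1 := by
  rw [intervalIntegrable_iff_integrableOn_Ioo_of_le zero_le_one]
  exact h.1.integrable (by norm_num)

theorem intervalIntegral_eq_of_tsupport_subset {k : ℝ → ℝ} (hk : tsupport k ⊆ Ioo (0 : ℝ) 1)
    (z : ℝ → ℝ) : ∫ t in (0 : ℝ)..1, z t * k t = ∫ t, k t • z t := by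
  rw [intervalIntegral.integral_of_le zero_le_one, ← integral_indicator measurableSet_Ioc]
  congr 1
  ext t
  by_cases ht : t ∈ Ioc (0 : ℝ) 1
  · simp [ht, mul_comm]
  · have : k t = 0 := by
      by_contra h0
      exact ht (Ioo_subset_Ioc_self (hk (subset_tsupport _ h0)))
    simp [ht, this]

theorem ae_eq_zero_of_forall_integral_mul_test {z : ℝ → ℝ}
    (hz : IntervalIntegrable z volume 0 1)
    (h : ∀ η : ℝ → ℝ, ContDiff ℝ ∞ η → HasCompactSupport η → tsupport η ⊆ Ioo (0 : ℝ) 1 →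
      ∫ t in (0 : ℝ)..1, z t * η t = 0) :
    ∀ᵐ t, t ∈ Ioo (0 : ℝ) 1 → z t = 0 := by
  rw [intervalIntegrable_iff_integrableOn_Ioo_of_le zero_le_one] at hz
  refine isOpen_Ioo.ae_eq_zero_of_integral_contDiff_smul_eq_zero hz.locallyIntegrableOn ?_
  intro η h1 h2 h3
  rw [← intervalIntegral_eq_of_tsupport_subset h3]
  exact h η h1 h2 h3

/-- Weak derivatives are unique up to a null set of `(0,1)`. -/
theorem HasWeakDerivL2.ae_eq {u w w' : ℝ → ℝ} (h : HasWeakDerivL2 u w)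
    (h' : HasWeakDerivL2 u w') : ∀ᵐ t, t ∈ Ioo (0 : ℝ) 1 → w t = w' t := by
  have hi := h.intervalIntegrable
  have hi' := h'.intervalIntegrable
  have := ae_eq_zero_of_forall_integral_mul_test (z := fun t => w t - w' t) (hi.sub hi') ?_
  · filter_upwards [this] with t ht h0
    linarith [ht h0]
  · intro η h1 h2 h3
    have e1 := h.2 η h1 h2 h3
    have e2 := h'.2 η h1 h2 h3
    simp only [sub_mul]
    rw [intervalIntegral.integral_sub (hi.mul_continuousOn h1.continuous.continuousOn)
      (hi'.mul_continuousOn h1.continuous.continuousOn)]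
    linarith

theorem exists_Icc_of_isCompact_subset_Ioo {s : Set ℝ} (hs : IsCompact s)
    (h : s ⊆ Ioo (0 : ℝ) 1) : ∃ a b, 0 < a ∧ b < 1 ∧ s ⊆ Icc a b := by
  rcases s.eq_empty_or_nonempty with rfl | hne
  · exact ⟨1, 0, by norm_num, by norm_num, by simp⟩
  · obtain ⟨a, ha⟩ := hs.exists_isLeast hne
    obtain ⟨b, hb⟩ := hs.exists_isGreatest hne
    exact ⟨a, b, (h ha.1).1, (h hb.1).2, fun x hx => ⟨ha.2 hx, hb.2 hx⟩⟩

/-- The primitive of a test function on `(0,1)` with zero mean is again a test function. -/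
theorem exists_test_primitive {k : ℝ → ℝ} (hk : ContDiff ℝ ∞ k) (hc : HasCompactSupport k)
    (hs : tsupport k ⊆ Ioo (0 : ℝ) 1) (h0 : ∫ t in (0 : ℝ)..1, k t = 0) :
    ∃ η : ℝ → ℝ, ContDiff ℝ ∞ η ∧ HasCompactSupport η ∧ tsupport η ⊆ Ioo (0 : ℝ) 1 ∧
      deriv η = k := by
  obtain ⟨a, b, ha, hb, hab⟩ := exists_Icc_of_isCompact_subset_Ioo hc hs
  have hd : ∀ t, HasDerivAt (fun t => ∫ s in (0 : ℝ)..t, k s) (k t) t := fun t =>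
    intervalIntegral.integral_hasDerivAt_right (hk.continuous.intervalIntegrable _ _)
      hk.continuous.stronglyMeasurable.stronglyMeasurableAtFilter hk.continuous.continuousAt
  have hderiv : deriv (fun t => ∫ s in (0 : ℝ)..t, k s) = k := funext fun t => (hd t).deriv
  have hz : ∀ s, s ∉ Icc a b → k s = 0 := fun s hns => by
    by_contra h
    exact hns (hab (subset_tsupport _ h))
  have hsub : tsupport (fun t => ∫ s in (0 : ℝ)..t, k s) ⊆ Icc a b := by
    refine closure_minimal (fun t ht => ?_) isClosed_Icc
    by_contra hn
    apply ht
    rcases lt_or_ge t a with h | h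
    · show ∫ s in (0 : ℝ)..t, k s = 0
      rw [intervalIntegral.integral_congr (g := fun _ => (0 : ℝ)), intervalIntegral.integral_zero]
      intro s hs
      apply hz
      rintro ⟨h1, -⟩
      rcases mem_uIcc.1 hs with h2 | h2 <;> linarith [h2.1, h2.2]
    · have hbt : b < t := by
        by_contra h'
        exact hn ⟨h, not_lt.1 h'⟩
      show ∫ s in (0 : ℝ)..t, k s = 0
      rw [← intervalIntegral.integral_add_adjacent_intervals
        (hk.continuous.intervalIntegrable 0 1) (hk.continuous.intervalIntegrable 1 t), h0,
        intervalIntegral.integral_congr (g := fun _ => (0 : ℝ)), intervalIntegral.integral_zero,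
        add_zero]
      intro s hs
      apply hz
      rintro ⟨-, h1⟩
      rcases mem_uIcc.1 hs with h2 | h2 <;> linarith [h2.1, h2.2]
  refine ⟨fun t => ∫ s in (0 : ℝ)..t, k s, ?_, ?_, ?_, hderiv⟩
  · rw [contDiff_infty_iff_deriv, hderiv]
    exact ⟨fun t => (hd t).differentiableAt, hk⟩
  · exact HasCompactSupport.intro isCompact_Icc fun t ht => by
      by_contra h
      exact ht (hsub (subset_tsupport _ h))
  · exact fun t ht => ⟨ha.trans_le (hsub ht).1, (hsub ht).2.trans_lt hb⟩

/-- **Du Bois-Reymond lemma**: a continuous function with zero weak derivative is constant. -/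
theorem exists_const_of_forall_integral_mul_deriv_test {z : ℝ → ℝ}
    (hz : ContinuousOn z (Icc 0 1))
    (h : ∀ η : ℝ → ℝ, ContDiff ℝ ∞ η → HasCompactSupport η → tsupport η ⊆ Ioo (0 : ℝ) 1 →
      ∫ t in (0 : ℝ)..1, z t * deriv η t = 0) :
    ∃ c, ∀ t ∈ Icc (0 : ℝ) 1, z t = c := by
  let ρ : ContDiffBump (1 / 2 : ℝ) := ⟨1 / 8, 1 / 4, by norm_num, by norm_num⟩
  have hρs : tsupport ρ ⊆ Ioo (0 : ℝ) 1 := by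
    rw [ρ.tsupport_eq, Real.closedBall_eq_Icc]
    intro t ht
    simp only [ρ] at ht
    constructor <;> linarith [ht.1, ht.2]
  have hρd : ContDiff ℝ ∞ ρ := ρ.contDiff
  have hzi : IntervalIntegrable z volume 0 1 := by
    apply ContinuousOn.intervalIntegrable
    rwa [uIcc_of_le zero_le_one]
  have hρpos : ∫ t in (0 : ℝ)..1, ρ t ≠ 0 := by
    have e := intervalIntegral_eq_of_tsupport_subset hρs 1
    simp only [Pi.one_apply, one_mul, smul_eq_mul, mul_one] at e
    rw [e]
    exact ρ.integral_pos.ne'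
  set I := ∫ t in (0 : ℝ)..1, ρ t with hI
  set C := (∫ t in (0 : ℝ)..1, z t * ρ t) / I with hC
  have key := ae_eq_zero_of_forall_integral_mul_test (z := fun t => z t - C)
    (hzi.sub intervalIntegrable_const) ?_
  · refine ⟨C, fun t ht => ?_⟩
    refine Measure.eqOn_Icc_of_ae_eq volume (f := z) (g := fun _ => C) zero_ne_one ?_ hz
      continuousOn_const ht
    rw [Filter.EventuallyEq, ← restrict_Ioo_eq_restrict_Icc, ae_restrict_iff' measurableSet_Ioo]
    filter_upwards [key] with t ht h0
    linarith [ht h0]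
  · intro ψ p1 p2 p3
    set J := ∫ t in (0 : ℝ)..1, ψ t with hJ
    have hψi := p1.continuous.intervalIntegrable (μ := volume) 0 1
    have hρi := hρd.continuous.intervalIntegrable (μ := volume) 0 1
    have hzψ := hzi.mul_continuousOn p1.continuous.continuousOn
    have hzρ := hzi.mul_continuousOn hρd.continuous.continuousOn
    have hsup : tsupport (fun t => ψ t - J / I * ρ t) ⊆ tsupport ψ ∪ tsupport ρ := by
      refine closure_minimal (fun t ht => ?_)
        ((isClosed_tsupport _).union (isClosed_tsupport _))
      by_contra hn
      rw [mem_union, not_or] at hn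
      apply ht
      simp [image_eq_zero_of_notMem_tsupport hn.1, image_eq_zero_of_notMem_tsupport hn.2]
    -- Subtracting a multiple of `ρ` makes the mean of `ψ` vanish.
    obtain ⟨η, e1, e2, e3, e4⟩ := exists_test_primitive (k := fun t => ψ t - J / I * ρ t)
      (p1.sub (contDiff_const.mul hρd))
      ((p2.union ρ.hasCompactSupport).of_isClosed_subset (isClosed_tsupport _) hsup)
      (hsup.trans (union_subset p3 hρs)) (by
        rw [intervalIntegral.integral_sub hψi (hρi.const_mul _),
          intervalIntegral.integral_const_mul]
        field_simp
        simp [hJ, hI])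
    have := h η e1 e2 e3
    rw [e4] at this
    have e : ∀ t, z t * (ψ t - J / I * ρ t) = z t * ψ t - J / I * (z t * ρ t) := fun t => by ring
    simp only [e] at this
    rw [intervalIntegral.integral_sub hzψ (hzρ.const_mul _),
      intervalIntegral.integral_const_mul] at this
    simp only [sub_mul]
    rw [intervalIntegral.integral_sub hzψ (hψi.const_mul _),
      intervalIntegral.integral_const_mul]
    have hcomm : C * J = J / I * ∫ t in (0 : ℝ)..1, z t * ρ t := by
      rw [hC]
      ring
    rw [← hJ, hcomm, this]

/-- An element of `H₀¹` is the primitive of its weak derivative. -/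
theorem HasWeakDerivL2.eq_primitive {v w : ℝ → ℝ} (hv : ContinuousOn v (Icc 0 1))
    (h0 : v 0 = 0) (h : HasWeakDerivL2 v w) {t : ℝ} (ht : t ∈ Icc (0 : ℝ) 1) :
    v t = ∫ s in (0 : ℝ)..t, w s := by
  have hi := h.intervalIntegrable
  have hz0 : (0 : ℝ) ∈ uIcc (0 : ℝ) 1 := by simp
  have hac := hi.absolutelyContinuousOnInterval_intervalIntegral hz0
  have hW : ContinuousOn (fun t => ∫ s in (0 : ℝ)..t, w s) (Icc 0 1) := by
    have := hac.continuousOn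
    rwa [uIcc_of_le zero_le_one] at this
  have hvi : IntervalIntegrable v volume 0 1 := by
    apply ContinuousOn.intervalIntegrable
    rwa [uIcc_of_le zero_le_one]
  have hWi : IntervalIntegrable (fun t => ∫ s in (0 : ℝ)..t, w s) volume 0 1 := by
    apply ContinuousOn.intervalIntegrable
    rwa [uIcc_of_le zero_le_one]
  obtain ⟨c, hc⟩ := exists_const_of_forall_integral_mul_deriv_test (hv.sub hW) (by
    intro η e1 e2 e3
    have hη' : Continuous (deriv η) := e1.continuous_deriv (by simp)
    have hout : ∀ t, t ∉ Ioo (0 : ℝ) 1 → η t = 0 := fun t ht =>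
      image_eq_zero_of_notMem_tsupport fun h => ht (e3 h)
    have hη0 : η 0 = 0 := hout 0 (by simp)
    have hη1 : η 1 = 0 := hout 1 (by simp)
    have hηac : AbsolutelyContinuousOnInterval η 0 1 :=
      (e1.of_le (by simp)).contDiffOn.absolutelyContinuousOnInterval
    have ibp := hac.integral_deriv_mul_eq_sub hηac
    have : ∫ x in (0 : ℝ)..1, (deriv (fun t => ∫ s in (0 : ℝ)..t, w s) x * η x +
        (∫ s in (0 : ℝ)..x, w s) * deriv η x) =
        ∫ x in (0 : ℝ)..1, (w x * η x + (∫ s in (0 : ℝ)..x, w s) * deriv η x) := by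
      apply intervalIntegral.integral_congr_ae
      filter_upwards [hi.ae_hasDerivAt_integral] with x h1 hx
      rw [(h1 (uIoc_subset_uIcc hx) 0 hz0).deriv]
    rw [this, intervalIntegral.integral_add (hi.mul_continuousOn e1.continuous.continuousOn)
      (hWi.mul_continuousOn hη'.continuousOn), hη0, hη1] at ibp
    have e := h.2 η e1 e2 e3
    simp only [Pi.sub_apply, sub_mul]
    rw [intervalIntegral.integral_sub (hvi.mul_continuousOn hη'.continuousOn)
      (hWi.mul_continuousOn hη'.continuousOn)]
    linarith)
  have a0 := hc 0 (by simp)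
  have a1 := hc t ht
  simp only [Pi.sub_apply, intervalIntegral.integral_same] at a0 a1
  linarith

/-- The primitive of a continuous function has it as weak derivative. -/
theorem hasWeakDerivL2_primitive {p : ℝ → ℝ} (hp : Continuous p) :
    HasWeakDerivL2 (fun t => ∫ s in (0 : ℝ)..t, p s) p := by
  constructor
  · obtain ⟨C, hC⟩ := isCompact_Icc.exists_bound_of_continuousOn (hp.continuousOn (s := Icc 0 1))
    refine MemLp.of_bound hp.aestronglyMeasurable C ?_
    rw [ae_restrict_iff' measurableSet_Ioo]
    exact Filter.Eventually.of_forall fun t ht => hC t (Ioo_subset_Icc_self ht)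
  · intro η e1 e2 e3
    have hη' : Continuous (deriv η) := e1.continuous_deriv (by simp)
    have hout : ∀ t, t ∉ Ioo (0 : ℝ) 1 → η t = 0 := fun t ht =>
      image_eq_zero_of_notMem_tsupport fun h => ht (e3 h)
    have hη0 : η 0 = 0 := hout 0 (by simp)
    have hη1 : η 1 = 0 := hout 1 (by simp)
    have hd : ∀ t, HasDerivAt (fun t => ∫ s in (0 : ℝ)..t, p s) (p t) t := fun t =>
      intervalIntegral.integral_hasDerivAt_right (hp.intervalIntegrable _ _)
        hp.stronglyMeasurable.stronglyMeasurableAtFilter hp.continuousAt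
    rw [intervalIntegral.integral_mul_deriv_eq_deriv_mul (fun x _ => hd x)
      (fun x _ => ((e1.differentiable (by simp)) x).hasDerivAt) (hp.intervalIntegrable _ _)
      (hη'.intervalIntegrable _ _), hη0, hη1]
    simp

/-- The chosen `weakDeriv u` agrees with any weak derivative that is known explicitly. -/
theorem weakDeriv_ae_eq {u w : ℝ → ℝ} (h : HasWeakDerivL2 u w) :
    ∀ᵐ t, t ∈ Ioo (0 : ℝ) 1 → weakDeriv u t = w t := by
  have hex : ∃ w, HasWeakDerivL2 u w := ⟨w, h⟩
  have : HasWeakDerivL2 u (weakDeriv u) := by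
    rw [weakDeriv, dif_pos hex]
    exact hex.choose_spec
  exact this.ae_eq h

theorem innerH01_eq {u v p q : ℝ → ℝ} (hu : HasWeakDerivL2 u p) (hv : HasWeakDerivL2 v q) :
    innerH01 u v = ∫ t in (0 : ℝ)..1, p t * q t := by
  rw [innerH01, intervalIntegral.integral_of_le zero_le_one,
    intervalIntegral.integral_of_le zero_le_one, integral_Ioc_eq_integral_Ioo,
    integral_Ioc_eq_integral_Ioo]
  refine setIntegral_congr_ae measurableSet_Ioo ?_
  filter_upwards [weakDeriv_ae_eq hu, weakDeriv_ae_eq hv] with t h1 h2 ht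
  rw [h1 ht, h2 ht]

/-- Integration by parts against an element of `H₀¹`, for `u'` a primitive of `-h`. -/
theorem innerH01_primitive {h v : ℝ → ℝ} (hh : IntervalIntegrable h volume 0 1)
    (hp : Continuous fun t => ∫ s in t..(1 / 2 : ℝ), h s) (hv : MemH01 v) :
    innerH01 (fun t => ∫ s in (0 : ℝ)..t, ∫ x in s..(1 / 2 : ℝ), h x) v =
      ∫ t in (0 : ℝ)..1, h t * v t := by
  obtain ⟨w, hw⟩ := hv.weak
  rw [innerH01_eq (hasWeakDerivL2_primitive hp) hw]
  have hi := hw.intervalIntegrable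
  have hvt : ∀ t ∈ Icc (0 : ℝ) 1, v t = ∫ s in (0 : ℝ)..t, w s :=
    fun t ht => hw.eq_primitive hv.continuousOn hv.left ht
  have ibp := integral_mul_primitive_add (c := 1 / 2) (d := 0) hh hi
    (by rw [uIcc_of_le zero_le_one]; constructor <;> norm_num) (by simp)
  rw [← hvt 1 (by simp), ← hvt 0 (by simp), hv.left, hv.right, mul_zero, mul_zero, sub_zero] at ibp
  have hvi : ContinuousOn v (uIcc 0 1) := by
    rw [uIcc_of_le zero_le_one]
    exact hv.continuousOn
  have e : ∫ x in (0 : ℝ)..1, (h x * (∫ s in (0 : ℝ)..x, w s) +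
      (∫ s in (1 / 2 : ℝ)..x, h s) * w x) =
      ∫ x in (0 : ℝ)..1, (h x * v x - (∫ s in x..(1 / 2 : ℝ), h s) * w x) := by
    apply intervalIntegral.integral_congr
    intro x hx
    rw [uIcc_of_le zero_le_one] at hx
    simp only
    rw [hvt x hx, intervalIntegral.integral_symm x (1 / 2 : ℝ)]
    ring
  rw [e, intervalIntegral.integral_sub (hh.mul_continuousOn hvi)
    (hi.continuousOn_mul hp.continuousOn)] at ibp
  linarith

/-! ### The initial value problem at the midpoint -/

/-- `∫_t^{1/2} h`, the derivative at `t` of the solution of `-u'' = h` with `u'(1/2) = 0`. -/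
noncomputable def flux (h : ℝ → ℝ) (t : ℝ) : ℝ := ∫ s in t..(1 / 2 : ℝ), h s

theorem intervalIntegrable_of_measurable_of_abs_le {G : ℝ → ℝ} {B : ℝ} (hG : Measurable G)
    (hB : ∀ t, |G t| ≤ B) (a b : ℝ) : IntervalIntegrable G volume a b :=
  (intervalIntegrable_const (c := B)).mono_fun hG.aestronglyMeasurable
    (Filter.Eventually.of_forall fun t => (hB t).trans (le_abs_self B))

theorem flux_eq_neg (h : ℝ → ℝ) : flux h = -fun t => ∫ s in (1 / 2 : ℝ)..t, h s :=
  funext fun t => intervalIntegral.integral_symm (1 / 2 : ℝ) t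

theorem continuous_flux {h : ℝ → ℝ} (hh : ∀ a b, IntervalIntegrable h volume a b) :
    Continuous (flux h) := by
  rw [flux_eq_neg]
  exact (intervalIntegral.continuous_primitive hh _).neg

theorem continuous_flux_flux {h : ℝ → ℝ} (hh : ∀ a b, IntervalIntegrable h volume a b) :
    Continuous (flux (flux h)) :=
  continuous_flux fun a b => (continuous_flux hh).intervalIntegrable a b

/-- Exponential bounds improve by the factor `1 / l` under integration from the midpoint. -/
theorem abs_flux_le_exp {h : ℝ → ℝ} {A l t : ℝ} (hl : 0 < l) (hA : 0 ≤ A) (ht : t ≤ 1 / 2)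
    (hb : ∀ s ∈ Icc t (1 / 2), |h s| ≤ A * Real.exp (l * (1 / 2 - s))) :
    |flux h t| ≤ A / l * Real.exp (l * (1 / 2 - t)) := by
  have hd : ∀ s : ℝ, HasDerivAt (fun s => -(A / l) * Real.exp (l * (1 / 2 - s)))
      (A * Real.exp (l * (1 / 2 - s))) s := fun s => by
    have h1 : HasDerivAt (fun s : ℝ => l * (1 / 2 - s)) (-l) s := by
      simpa using ((hasDerivAt_id s).const_sub (1 / 2 : ℝ)).const_mul l
    have e : A * Real.exp (l * (1 / 2 - s)) =
        -(A / l) * (Real.exp (l * (1 / 2 - s)) * -l) := by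
      field_simp
    rw [e]
    exact h1.exp.const_mul (-(A / l))
  have hcont : Continuous fun s : ℝ => A * Real.exp (l * (1 / 2 - s)) := by fun_prop
  have h1 : |flux h t| ≤ ∫ s in t..(1 / 2 : ℝ), A * Real.exp (l * (1 / 2 - s)) := by
    have := intervalIntegral.norm_integral_le_of_norm_le (f := h) ht
      (Filter.Eventually.of_forall fun s hs => hb s (Ioc_subset_Icc_self hs))
      (hcont.intervalIntegrable (μ := volume) t (1 / 2))
    exact this
  refine h1.trans ?_
  rw [intervalIntegral.integral_eq_sub_of_hasDerivAt (fun s _ => hd s)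
    (hcont.intervalIntegrable _ _)]
  have : 0 ≤ A / l := by positivity
  simp only [sub_self, mul_zero, Real.exp_zero]
  linarith

/-- For each midpoint value `m` the initial value problem `-u'' = G(t) F(u)`,
`u(1/2) = m`, `u'(1/2) = 0`, in integrated form, is solvable on `[0,1/2]`, and the solution
depends on `m` continuously. -/
theorem exists_shooting_family {G F : ℝ → ℝ} {B : ℝ} {L : NNReal} (hG : Measurable G)
    (hB : ∀ t, |G t| ≤ B) (hF : LipschitzWith L F) :
    ∃ u : ℝ → ℝ → ℝ, (∀ m, Continuous (u m)) ∧
      (∀ m, ∀ t ∈ Icc (0 : ℝ) (1 / 2), u m t = m - flux (flux fun s => G s * F (u m s)) t) ∧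
      ∀ t, Continuous fun m => u m t := by
  have hB0 : 0 ≤ B := (abs_nonneg _).trans (hB 0)
  have hGi := intervalIntegrable_of_measurable_of_abs_le hG hB
  -- In the unknown `w(t) = exp (-l (1/2 - t)) u(t)` the integral operator is a contraction as
  -- soon as `B L / l² ≤ 1/2`.
  obtain ⟨l, hl1, hlBL⟩ : ∃ l : ℝ, 1 ≤ l ∧ 2 * (B * L) ≤ l :=
    ⟨1 + 2 * (B * L), by have : 0 ≤ B * (L : ℝ) := by positivity
                         linarith, by linarith⟩
  have hl0 : 0 < l := by linarith
  let rhs : (ℝ → ℝ) → ℝ → ℝ := fun w s => G s * F (Real.exp (l * (1 / 2 - s)) * w s)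
  have hrhs : ∀ w : ℝ → ℝ, Continuous w → ∀ a b, IntervalIntegrable (rhs w) volume a b :=
    fun w hw a b => (hGi a b).mul_continuousOn
      (hF.continuous.comp (by fun_prop)).continuousOn
  let Ψ : ℝ → (ℝ → ℝ) → ℝ → ℝ := fun m w t =>
    Real.exp (-(l * (1 / 2 - t))) * (m - flux (flux (rhs w)) t)
  have hΨ : ∀ m w, Continuous w → Continuous (Ψ m w) := fun m w hw => by
    have := continuous_flux_flux (hrhs w hw)
    fun_prop
  -- Precomposition with the projection `κ` onto `[0,1/2]` yields bounded functions on `ℝ`.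
  let κ : ℝ → ℝ := fun t => projIcc (0 : ℝ) (1 / 2) (by norm_num) t
  have hκ : Continuous κ := by fun_prop
  have hκm : ∀ t, κ t ∈ Icc (0 : ℝ) (1 / 2) := fun t => Subtype.prop _
  have hκe : ∀ t ∈ Icc (0 : ℝ) (1 / 2), κ t = t := fun t ht => by
    simp only [κ]
    rw [projIcc_of_mem _ ht]
  have hbd : ∀ m (w : BoundedContinuousFunction ℝ ℝ), ∃ C, ∀ t, ‖Ψ m w (κ t)‖ ≤ C := by
    intro m w
    obtain ⟨C, hC⟩ := (isCompact_Icc (a := (0 : ℝ)) (b := 1 / 2)).exists_bound_of_continuousOn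
      (hΨ m w w.continuous).continuousOn
    exact ⟨C, fun t => hC _ (hκm t)⟩
  choose C hC using hbd
  let Φ : ℝ → BoundedContinuousFunction ℝ ℝ → BoundedContinuousFunction ℝ ℝ := fun m w =>
    BoundedContinuousFunction.ofNormedAddCommGroup (fun t => Ψ m w (κ t))
      ((hΨ m w w.continuous).comp hκ) (C m w) (hC m w)
  have hΦ : ∀ m w t, Φ m w t = Ψ m w (κ t) := fun _ _ _ => rfl
  have hΨl : ∀ m (w w' : BoundedContinuousFunction ℝ ℝ), ∀ t ∈ Icc (0 : ℝ) (1 / 2),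
      |Ψ m w t - Ψ m w' t| ≤ 1 / 2 * dist w w' := by
    intro m w w' t ht
    set D := dist w w' with hD
    have hD0 : 0 ≤ D := dist_nonneg
    have b0 : ∀ s : ℝ, |rhs w s - rhs w' s| ≤ B * L * D * Real.exp (l * (1 / 2 - s)) := by
      intro s
      have e1 := hF.dist_le_mul (Real.exp (l * (1 / 2 - s)) * w s)
        (Real.exp (l * (1 / 2 - s)) * w' s)
      have e2 : |w s - w' s| ≤ D := by
        have := w.dist_coe_le_dist (g := w') s
        rwa [Real.dist_eq] at this
      rw [Real.dist_eq, Real.dist_eq, ← mul_sub, abs_mul, Real.abs_exp] at e1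
      simp only [rhs]
      rw [← mul_sub, abs_mul]
      calc |G s| * |F (Real.exp (l * (1 / 2 - s)) * w s) - F (Real.exp (l * (1 / 2 - s)) * w' s)|
          ≤ B * (L * (Real.exp (l * (1 / 2 - s)) * D)) := by
            refine mul_le_mul (hB s) (e1.trans ?_) (abs_nonneg _) hB0
            gcongr
        _ = _ := by ring
    have fsub : ∀ σ, flux (rhs w) σ - flux (rhs w') σ = flux (fun s => rhs w s - rhs w' s) σ :=
      fun σ => (intervalIntegral.integral_sub (hrhs w w.continuous _ _)
        (hrhs w' w'.continuous _ _)).symm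
    have b1 : ∀ σ ∈ Icc t (1 / 2), |flux (rhs w) σ - flux (rhs w') σ| ≤
        B * L * D / l * Real.exp (l * (1 / 2 - σ)) := fun σ hσ => by
      rw [fsub]
      exact abs_flux_le_exp hl0 (by positivity) hσ.2 fun s _ => b0 s
    have b2 : |flux (flux (rhs w)) t - flux (flux (rhs w')) t| ≤
        B * L * D / l / l * Real.exp (l * (1 / 2 - t)) := by
      have : flux (flux (rhs w)) t - flux (flux (rhs w')) t =
          flux (fun σ => flux (rhs w) σ - flux (rhs w') σ) t :=
        (intervalIntegral.integral_sub
          ((continuous_flux (hrhs w w.continuous)).intervalIntegrable _ _)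
          ((continuous_flux (hrhs w' w'.continuous)).intervalIntegrable _ _)).symm
      rw [this]
      exact abs_flux_le_exp hl0 (by positivity) ht.2 b1
    have e3 : Ψ m w t - Ψ m w' t = Real.exp (-(l * (1 / 2 - t))) *
        -(flux (flux (rhs w)) t - flux (flux (rhs w')) t) := by
      simp only [Ψ]
      ring
    rw [e3, abs_mul, abs_neg, Real.abs_exp]
    calc Real.exp (-(l * (1 / 2 - t))) * |flux (flux (rhs w)) t - flux (flux (rhs w')) t|
        ≤ Real.exp (-(l * (1 / 2 - t))) * (B * L * D / l / l * Real.exp (l * (1 / 2 - t))) := by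
          gcongr
      _ = B * L * D / l / l := by
          rw [Real.exp_neg]
          field_simp
      _ ≤ 1 / 2 * D := by
          rw [div_div, div_le_iff₀ (by positivity)]
          have : 2 * (B * L) ≤ l * l := hlBL.trans (by nlinarith)
          nlinarith
  have hcontr : ∀ m, ContractingWith (1 / 2) (Φ m) := fun m => by
    refine ⟨by rw [← NNReal.coe_lt_coe]; norm_num, LipschitzWith.of_dist_le_mul fun w w' => ?_⟩
    rw [BoundedContinuousFunction.dist_le (by positivity)]
    intro t
    rw [hΦ, hΦ, Real.dist_eq]
    simpa using hΨl m w w' (κ t) (hκm t)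
  let w : ℝ → BoundedContinuousFunction ℝ ℝ := fun m => (hcontr m).fixedPoint
  have hw : ∀ m, Φ m (w m) = w m := fun m => (hcontr m).fixedPoint_isFixedPt
  have hwt : ∀ m, ∀ t ∈ Icc (0 : ℝ) (1 / 2), w m t = Ψ m (w m) t := fun m t ht => by
    have := hΦ m (w m) t
    rwa [hw, hκe t ht] at this
  have hdist : ∀ m m', dist (w m) (w m') ≤ 2 * |m - m'| := by
    intro m m'
    have : dist (w m) (w m') ≤ 1 / 2 * dist (w m) (w m') + |m - m'| := by
      have hnn : 0 ≤ 1 / 2 * dist (w m) (w m') + |m - m'| := by positivity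
      rw [BoundedContinuousFunction.dist_le hnn]
      intro t
      rw [← hw m, ← hw m', hΦ, hΦ, Real.dist_eq, hw m, hw m']
      have e1 := hΨl m (w m) (w m') _ (hκm t)
      have e2 : |Ψ m (w m') (κ t) - Ψ m' (w m') (κ t)| ≤ |m - m'| := by
        have : Ψ m (w m') (κ t) - Ψ m' (w m') (κ t) =
            Real.exp (-(l * (1 / 2 - κ t))) * (m - m') := by
          simp only [Ψ]
          ring
        rw [this, abs_mul, Real.abs_exp]
        refine mul_le_of_le_one_left (abs_nonneg _) (Real.exp_le_one_iff.2 ?_)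
        have := mul_nonneg hl0.le (sub_nonneg.2 (hκm t).2)
        linarith
      exact (abs_sub_le _ _ _).trans (add_le_add e1 e2)
    linarith
  refine ⟨fun m t => Real.exp (l * (1 / 2 - t)) * w m t, ?_, ?_, ?_⟩
  · intro m
    fun_prop
  · intro m t ht
    simp only
    rw [hwt m t ht]
    simp only [Ψ, rhs]
    rw [← mul_assoc, ← Real.exp_add, add_neg_cancel, Real.exp_zero, one_mul]
  · intro t
    have hlip : LipschitzWith 2 fun m => w m t := LipschitzWith.of_dist_le_mul fun m m' =>
      ((w m).dist_coe_le_dist (g := w m') t).trans (hdist m m')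
    exact continuous_const.mul hlip.continuous

/-! ### Energy, Harnack and Wirtinger inequalities -/

/-- The squared energetic norm of the solution of `-u'' = h`, `u(0) = u(1) = 0`, for `h`
symmetric about `1/2`. -/
noncomputable def energy (h : ℝ → ℝ) : ℝ := 2 * ∫ t in (0 : ℝ)..(1 / 2), flux h t ^ 2

theorem flux_le_flux {h k : ℝ → ℝ} (hh : ∀ a b, IntervalIntegrable h volume a b)
    (hk : ∀ a b, IntervalIntegrable k volume a b) {t : ℝ} (ht : t ≤ 1 / 2)
    (hle : ∀ s ∈ Icc t (1 / 2), h s ≤ k s) : flux h t ≤ flux k t :=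
  intervalIntegral.integral_mono_on ht (hh _ _) (hk _ _) hle

theorem flux_nonneg {h : ℝ → ℝ} {t : ℝ} (ht : t ≤ 1 / 2)
    (h0 : ∀ s ∈ Icc t (1 / 2), 0 ≤ h s) : 0 ≤ flux h t :=
  intervalIntegral.integral_nonneg ht h0

theorem energy_le_energy {h k : ℝ → ℝ} (hh : ∀ a b, IntervalIntegrable h volume a b)
    (hk : ∀ a b, IntervalIntegrable k volume a b)
    (h0 : ∀ s ∈ Icc (0 : ℝ) (1 / 2), 0 ≤ h s) (hle : ∀ s ∈ Icc (0 : ℝ) (1 / 2), h s ≤ k s) :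
    energy h ≤ energy k := by
  unfold energy
  gcongr
  refine intervalIntegral.integral_mono_on (by norm_num)
    (((continuous_flux hh).pow 2).intervalIntegrable _ _)
    (((continuous_flux hk).pow 2).intervalIntegrable _ _) fun t ht => ?_
  have := flux_nonneg ht.2 fun s hs => h0 s ⟨ht.1.trans hs.1, hs.2⟩
  have := flux_le_flux hh hk ht.2 fun s hs => hle s ⟨ht.1.trans hs.1, hs.2⟩
  gcongr

theorem energy_const_mul (c : ℝ) (h : ℝ → ℝ) :
    energy (fun s => c * h s) = c ^ 2 * energy h := by
  have : ∀ t, flux (fun s => c * h s) t = c * flux h t := fun t =>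
    intervalIntegral.integral_const_mul _ _
  simp only [energy, this, mul_pow, intervalIntegral.integral_const_mul]
  ring

/-- Cauchy–Schwarz: half the energetic norm bounds the maximum `u(1/2)`. -/
theorem integral_flux_le {h : ℝ → ℝ} (hh : ∀ a b, IntervalIntegrable h volume a b) :
    ∫ t in (0 : ℝ)..(1 / 2), flux h t ≤ Real.sqrt (energy h) / 2 := by
  have hq := continuous_flux hh
  set a := ∫ t in (0 : ℝ)..(1 / 2), flux h t with ha
  have h1 : 0 ≤ ∫ t in (0 : ℝ)..(1 / 2), (flux h t - 2 * a) ^ 2 :=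
    intervalIntegral.integral_nonneg (by norm_num) fun _ _ => sq_nonneg _
  have e : ∀ t, (flux h t - 2 * a) ^ 2 = flux h t ^ 2 - (4 * a) * flux h t + 4 * a ^ 2 :=
    fun t => by ring
  simp only [e] at h1
  rw [intervalIntegral.integral_add (Continuous.intervalIntegrable (by fun_prop) _ _)
    (by simp), intervalIntegral.integral_sub (Continuous.intervalIntegrable (by fun_prop) _ _)
    (Continuous.intervalIntegrable (by fun_prop) _ _), intervalIntegral.integral_const_mul,
    ← ha, intervalIntegral.integral_const, smul_eq_mul] at h1
  have h2 : (2 * a) ^ 2 ≤ energy h := by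
    unfold energy
    linarith
  linarith [Real.le_sqrt_of_sq_le h2]

theorem flux_antitoneOn {h : ℝ → ℝ} (hh : ∀ a b, IntervalIntegrable h volume a b)
    (h0 : ∀ s ∈ Icc (0 : ℝ) (1 / 2), 0 ≤ h s) : AntitoneOn (flux h) (Icc 0 (1 / 2)) := by
  intro s hs t ht hst
  have : flux h s = (∫ x in s..t, h x) + flux h t :=
    (intervalIntegral.integral_add_adjacent_intervals (hh _ _) (hh _ _)).symm
  rw [this]
  have : 0 ≤ ∫ x in s..t, h x := intervalIntegral.integral_nonneg hst fun x hx =>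
    h0 x ⟨hs.1.trans hx.1, hx.2.trans ht.2⟩
  linarith

/-- For nondecreasing `h` the derivative `u'` is concave on `[0,1/2]`, hence lies above its
chord from `0` to `1/2`. -/
theorem mul_flux_zero_le_flux {h : ℝ → ℝ} (hh : ∀ a b, IntervalIntegrable h volume a b)
    (hm : MonotoneOn h (Icc 0 (1 / 2))) {s : ℝ} (hs : s ∈ Icc (0 : ℝ) (1 / 2)) :
    (1 - 2 * s) * flux h 0 ≤ flux h s := by
  have e : flux h 0 = (∫ x in (0 : ℝ)..s, h x) + flux h s :=
    (intervalIntegral.integral_add_adjacent_intervals (hh _ _) (hh _ _)).symm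
  have h1 : ∫ x in (0 : ℝ)..s, h x ≤ ∫ x in (0 : ℝ)..s, h s :=
    intervalIntegral.integral_mono_on hs.1 (hh _ _) (by simp) fun x hx =>
      hm ⟨hx.1, hx.2.trans hs.2⟩ hs hx.2
  have h2 : ∫ x in s..(1 / 2 : ℝ), h s ≤ flux h s :=
    intervalIntegral.integral_mono_on hs.2 (by simp) (hh _ _) fun x hx =>
      hm hs ⟨hs.1.trans hx.1, hx.2⟩ hx.1
  rw [intervalIntegral.integral_const, smul_eq_mul] at h1 h2
  rw [e]
  nlinarith [mul_le_mul_of_nonneg_left h1 (by linarith [hs.2] : (0 : ℝ) ≤ 1 - 2 * s),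
    mul_le_mul_of_nonneg_left h2 (by linarith [hs.1] : (0 : ℝ) ≤ 2 * s)]

theorem sqrt_energy_le_flux_zero {h : ℝ → ℝ} (hh : ∀ a b, IntervalIntegrable h volume a b)
    (h0 : ∀ s ∈ Icc (0 : ℝ) (1 / 2), 0 ≤ h s) : Real.sqrt (energy h) ≤ flux h 0 := by
  have hp : 0 ≤ flux h 0 := flux_nonneg (by norm_num) h0
  refine Real.sqrt_le_iff.2 ⟨hp, ?_⟩
  have : ∫ t in (0 : ℝ)..(1 / 2), flux h t ^ 2 ≤ ∫ t in (0 : ℝ)..(1 / 2), flux h 0 ^ 2 := by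
    refine intervalIntegral.integral_mono_on (by norm_num)
      (((continuous_flux hh).pow 2).intervalIntegrable _ _) (by simp) fun t ht => ?_
    have := flux_nonneg ht.2 fun s hs => h0 s ⟨ht.1.trans hs.1, hs.2⟩
    have := flux_antitoneOn hh h0 (by simp) ht ht.1
    gcongr
  rw [intervalIntegral.integral_const, smul_eq_mul] at this
  unfold energy
  linarith

/-- **Harnack inequality** for the solution `u(t) = ∫_0^t flux h` of `-u'' = h`. -/
theorem phi_mul_sqrt_energy_le {h : ℝ → ℝ} (hh : ∀ a b, IntervalIntegrable h volume a b)
    (h0 : ∀ s ∈ Icc (0 : ℝ) (1 / 2), 0 ≤ h s) (hm : MonotoneOn h (Icc 0 (1 / 2)))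
    {t : ℝ} (ht : t ∈ Icc (0 : ℝ) (1 / 2)) :
    phi t * Real.sqrt (energy h) ≤ ∫ s in (0 : ℝ)..t, flux h s := by
  have h1 : ∫ s in (0 : ℝ)..t, flux h t ≤ ∫ s in (0 : ℝ)..t, flux h s :=
    intervalIntegral.integral_mono_on ht.1 (by simp)
      ((continuous_flux hh).intervalIntegrable _ _) fun s hs =>
      flux_antitoneOn hh h0 ⟨hs.1, hs.2.trans ht.2⟩ ht hs.2
  rw [intervalIntegral.integral_const, smul_eq_mul, sub_zero] at h1
  have h2 := mul_flux_zero_le_flux hh hm ht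
  have h3 := sqrt_energy_le_flux_zero hh h0
  have h4 : 0 ≤ 1 - 2 * t := by linarith [ht.2]
  calc phi t * Real.sqrt (energy h) = t * ((1 - 2 * t) * Real.sqrt (energy h)) := by
        unfold phi
        ring
    _ ≤ t * flux h t :=
        mul_le_mul_of_nonneg_left ((mul_le_mul_of_nonneg_left h3 h4).trans h2) ht.1
    _ ≤ _ := h1

/-- Mass of `h` on `[β,1/2]` bounds the energy from below. -/
theorem mul_sq_le_energy {h : ℝ → ℝ} (hh : ∀ a b, IntervalIntegrable h volume a b)
    (h0 : ∀ s ∈ Icc (0 : ℝ) (1 / 2), 0 ≤ h s) {β : ℝ} (hβ : β ∈ Icc (0 : ℝ) (1 / 2)) :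
    2 * β * flux h β ^ 2 ≤ energy h := by
  have hi : ∀ a b, IntervalIntegrable (fun t => flux h t ^ 2) volume a b := fun a b =>
    ((continuous_flux hh).pow 2).intervalIntegrable a b
  have e := intervalIntegral.integral_add_adjacent_intervals (hi 0 β) (hi β (1 / 2))
  have h1 : 0 ≤ ∫ t in β..(1 / 2 : ℝ), flux h t ^ 2 :=
    intervalIntegral.integral_nonneg hβ.2 fun _ _ => sq_nonneg _
  have h2 : ∫ t in (0 : ℝ)..β, flux h β ^ 2 ≤ ∫ t in (0 : ℝ)..β, flux h t ^ 2 := by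
    refine intervalIntegral.integral_mono_on hβ.1 (by simp) (hi _ _) fun t ht => ?_
    have := flux_nonneg hβ.2 fun s hs => h0 s ⟨hβ.1.trans hs.1, hs.2⟩
    have := flux_antitoneOn hh h0 ⟨ht.1, ht.2.trans hβ.2⟩ hβ ht.2
    gcongr
  rw [intervalIntegral.integral_const, smul_eq_mul] at h2
  unfold energy
  linarith

theorem tan_pi_mul_le {b : ℝ} (h0 : 0 ≤ b) (hb : b < 1 / 2) :
    Real.tan (Real.pi * b) ≤ 1 / (Real.pi * (1 / 2 - b)) := by
  have hpi := Real.pi_pos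
  have hy : 0 < Real.pi * (1 / 2 - b) := by
    have : 0 < 1 / 2 - b := by linarith
    positivity
  have hy2 : Real.pi * (1 / 2 - b) ≤ Real.pi / 2 := by nlinarith
  rcases h0.eq_or_lt with rfl | h0
  · simp only [mul_zero, Real.tan_zero]
    positivity
  · have hy3 : Real.pi * (1 / 2 - b) < Real.pi / 2 := by nlinarith
    have e : Real.pi * b = Real.pi / 2 - Real.pi * (1 / 2 - b) := by ring
    rw [e, Real.tan_pi_div_two_sub, one_div (Real.pi * _)]
    exact inv_anti₀ hy (Real.le_tan hy.le hy3)

/-- **Wirtinger inequality** with the sharp constant, for functions on `[0,1/2]` vanishing at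
`1/2`. -/
theorem energy_le_of_abs_le {G : ℝ → ℝ} {B : ℝ} (hG : Measurable G) (hB : ∀ t, |G t| ≤ B) :
    Real.pi ^ 2 * energy G ≤ 2 * ∫ t in (0 : ℝ)..(1 / 2), G t ^ 2 := by
  have hpi := Real.pi_pos
  have hB0 : 0 ≤ B := (abs_nonneg _).trans (hB 0)
  have hGi := intervalIntegrable_of_measurable_of_abs_le hG hB
  have hGsq := intervalIntegrable_of_measurable_of_abs_le (hG.pow_const 2) (B := B ^ 2)
    (fun t => by rw [abs_pow]; exact pow_le_pow_left₀ (abs_nonneg _) (hB t) 2)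
  have hP := continuous_flux hGi
  have key : ∀ b ∈ Ico (0 : ℝ) (1 / 2), Real.pi ^ 2 * ∫ t in (0 : ℝ)..b, flux G t ^ 2 ≤
      B ^ 2 * (1 / 2 - b) + ∫ t in (0 : ℝ)..(1 / 2), G t ^ 2 := by
    intro b hb
    have hcos : ∀ t ∈ Icc (0 : ℝ) b, 0 < Real.cos (Real.pi * t) := fun t ht =>
      Real.cos_pos_of_mem_Ioo ⟨by nlinarith [ht.1], by nlinarith [ht.2, hb.2]⟩
    -- `cos (π t)` is the extremal function. With `P = flux G`, `P' = -G`, one has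
    -- `k' + G² - π² P² = (G - π tan(π t) P)² ≥ 0`.
    let k : ℝ → ℝ := fun t => Real.pi * Real.tan (Real.pi * t) * (flux G t * flux G t)
    have hacP : AbsolutelyContinuousOnInterval (flux G) 0 b := by
      have := ((hGi 0 (1 / 2)).absolutelyContinuousOnInterval_intervalIntegral
        (c := 1 / 2) right_mem_uIcc).neg
      refine AbsolutelyContinuousOnInterval.mono (a := 0) (b := 1 / 2) ?_ ?_
      · rwa [flux_eq_neg]
      · rw [uIcc_of_le hb.1, uIcc_of_le (by norm_num)]
        exact Icc_subset_Icc_right hb.2.le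
    have htan : ContDiffOn ℝ 1 (fun t => Real.pi * Real.tan (Real.pi * t)) (uIcc 0 b) := by
      intro t ht
      rw [uIcc_of_le hb.1] at ht
      have : ContDiffAt ℝ 1 (fun t => Real.pi * Real.tan (Real.pi * t)) t :=
        contDiffAt_const.mul (ContDiffAt.comp (g := Real.tan) t
          (Real.contDiffAt_tan.2 (hcos t ht).ne') (contDiffAt_const.mul contDiffAt_id))
      exact this.contDiffWithinAt
    have hk : AbsolutelyContinuousOnInterval k 0 b :=
      htan.absolutelyContinuousOnInterval.fun_mul (hacP.fun_mul hacP)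
    have hint := hk.integral_deriv_eq_sub
    have hle : ∫ t in (0 : ℝ)..b, Real.pi ^ 2 * flux G t ^ 2 ≤
        ∫ t in (0 : ℝ)..b, (deriv k t + G t ^ 2) := by
      refine intervalIntegral.integral_mono_ae_restrict hb.1
        (Continuous.intervalIntegrable (by fun_prop) _ _)
        (hk.intervalIntegrable_deriv.add (hGsq _ _)) ?_
      rw [Filter.EventuallyLE, ae_restrict_iff' measurableSet_Icc]
      filter_upwards [(hGi 0 (1 / 2)).ae_hasDerivAt_integral] with t h1 ht
      have ht' : t ∈ uIcc (0 : ℝ) (1 / 2) := by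
        rw [uIcc_of_le (by norm_num)]
        exact ⟨ht.1, ht.2.trans hb.2.le⟩
      have dP : HasDerivAt (flux G) (-G t) t := by
        rw [flux_eq_neg]
        exact (h1 ht' (1 / 2) right_mem_uIcc).neg
      have dT : HasDerivAt (fun t => Real.pi * Real.tan (Real.pi * t))
          (Real.pi * (1 / Real.cos (Real.pi * t) ^ 2 * Real.pi)) t := by
        have h2 : HasDerivAt (fun t : ℝ => Real.pi * t) Real.pi t := by
          simpa using (hasDerivAt_id t).const_mul Real.pi
        exact ((Real.hasDerivAt_tan (hcos t ht).ne').comp t h2).const_mul Real.pi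
      have dk := (dT.mul (dP.mul dP)).deriv
      have dk' : deriv k t = Real.pi * (1 / Real.cos (Real.pi * t) ^ 2 * Real.pi) *
          (flux G t * flux G t) + Real.pi * Real.tan (Real.pi * t) *
          (-G t * flux G t + flux G t * -G t) := dk
      have hc := hcos t ht
      have hsec : 1 / Real.cos (Real.pi * t) ^ 2 = 1 + Real.tan (Real.pi * t) ^ 2 := by
        rw [Real.tan_eq_sin_div_cos, div_pow]
        field_simp
        linarith [Real.sin_sq_add_cos_sq (Real.pi * t)]
      rw [dk', hsec]
      nlinarith [sq_nonneg (G t - Real.pi * Real.tan (Real.pi * t) * flux G t)]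
    rw [intervalIntegral.integral_const_mul,
      intervalIntegral.integral_add hk.intervalIntegrable_deriv (hGsq _ _), hint] at hle
    have hk0 : k 0 = 0 := by simp [k]
    have hkb : k b ≤ B ^ 2 * (1 / 2 - b) := by
      have hb' : 0 < 1 / 2 - b := by linarith [hb.2]
      have hfl : |flux G b| ≤ B * (1 / 2 - b) := by
        have := intervalIntegral.norm_integral_le_of_norm_le_const (a := b) (b := 1 / 2)
          (f := G) (C := B) fun t _ => hB t
        rwa [abs_of_pos hb'] at this
      have hsq : flux G b * flux G b ≤ (B * (1 / 2 - b)) ^ 2 := by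
        rw [← sq, ← sq_abs]
        exact pow_le_pow_left₀ (abs_nonneg _) hfl 2
      have ht := tan_pi_mul_le hb.1 hb.2
      calc k b ≤ Real.pi * (1 / (Real.pi * (1 / 2 - b))) * (flux G b * flux G b) := by
            simp only [k]
            have := mul_self_nonneg (flux G b)
            gcongr
        _ ≤ Real.pi * (1 / (Real.pi * (1 / 2 - b))) * (B * (1 / 2 - b)) ^ 2 := by gcongr
        _ = B ^ 2 * (1 / 2 - b) := by
            field_simp
    have hsub : ∫ t in (0 : ℝ)..b, G t ^ 2 ≤ ∫ t in (0 : ℝ)..(1 / 2), G t ^ 2 := by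
      rw [← intervalIntegral.integral_add_adjacent_intervals (hGsq 0 b) (hGsq b (1 / 2))]
      have : 0 ≤ ∫ t in b..(1 / 2 : ℝ), G t ^ 2 :=
        intervalIntegral.integral_nonneg hb.2.le fun _ _ => sq_nonneg _
      linarith
    linarith
  -- The boundary term at `b` tends to `0` as `b → 1/2`.
  have hcl : (1 / 2 : ℝ) ∈ closure (Ico (0 : ℝ) (1 / 2)) := by
    rw [closure_Ico (by norm_num)]
    simp
  have c1 : Continuous fun b : ℝ => Real.pi ^ 2 * ∫ t in (0 : ℝ)..b, flux G t ^ 2 :=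
    continuous_const.mul (intervalIntegral.continuous_primitive
      (fun a b => (hP.pow 2).intervalIntegrable a b) 0)
  have c2 : Continuous fun b : ℝ =>
      B ^ 2 * (1 / 2 - b) + ∫ t in (0 : ℝ)..(1 / 2), G t ^ 2 := by fun_prop
  have : Real.pi ^ 2 * ∫ t in (0 : ℝ)..(1 / 2), flux G t ^ 2 ≤
      B ^ 2 * (1 / 2 - 1 / 2) + ∫ t in (0 : ℝ)..(1 / 2), G t ^ 2 :=
    closure_minimal (s := Ico (0 : ℝ) (1 / 2)) key (isClosed_le c1 c2) hcl
  rw [sub_self, mul_zero, zero_add] at this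
  unfold energy
  linarith

/-! ### Shooting -/

/-- Along a path on which `E` crosses the band `(a, b)`, a function `c` which is positive where
`E = a` and negative where `E = b` vanishes at some point where `E` lies inside the band. -/
theorem exists_zero_of_crossing {E c : ℝ → ℝ} (hE : Continuous E) (hc : Continuous c)
    {a b T : ℝ} (hT : 0 ≤ T) (hab : a < b) (h0 : E 0 < a) (hET : b ≤ E T)
    (ha : ∀ m ∈ Icc 0 T, E m = a → 0 < c m) (hb : ∀ m ∈ Icc 0 T, E m = b → c m < 0) :
    ∃ m ∈ Icc 0 T, c m = 0 ∧ a < E m ∧ E m < b := by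
  -- `m₂` is the first point where `b` is reached, `m₁` the last one before it with value `a`.
  obtain ⟨m₂, ⟨hm₂, hEm₂⟩, hmin⟩ :=
    (isCompact_Icc.inter_right (isClosed_le continuous_const hE) :
      IsCompact (Icc 0 T ∩ {m | b ≤ E m})).exists_isLeast ⟨T, ⟨hT, le_rfl⟩, hET⟩
  have e₂ : E m₂ = b := by
    obtain ⟨x, hx, hxb⟩ := intermediate_value_Icc hm₂.1 hE.continuousOn
      ⟨(h0.trans hab).le, hEm₂⟩
    have : m₂ ≤ x := hmin ⟨⟨hx.1, hx.2.trans hm₂.2⟩, hxb.ge⟩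
    rw [← le_antisymm hx.2 this, hxb]
  obtain ⟨m₁, ⟨hm₁, hEm₁⟩, hmax⟩ :=
    (isCompact_Icc.inter_right (isClosed_le hE continuous_const) :
      IsCompact (Icc 0 m₂ ∩ {m | E m ≤ a})).exists_isGreatest ⟨0, ⟨le_rfl, hm₂.1⟩, h0.le⟩
  have e₁ : E m₁ = a := by
    obtain ⟨x, hx, hxa⟩ := intermediate_value_Icc hm₁.2 hE.continuousOn
      ⟨hEm₁, hab.le.trans hEm₂⟩
    have : x ≤ m₁ := hmax ⟨⟨hm₁.1.trans hx.1, hx.2⟩, hxa.le⟩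
    rw [← le_antisymm this hx.1, hxa]
  have p₁ := ha m₁ ⟨hm₁.1, hm₁.2.trans hm₂.2⟩ e₁
  have p₂ := hb m₂ hm₂ e₂
  obtain ⟨m, hm, hcm⟩ := intermediate_value_Icc' hm₁.2 hc.continuousOn ⟨p₂.le, p₁.le⟩
  have n₁ : m ≠ m₁ := by
    rintro rfl
    exact p₁.ne' hcm
  have n₂ : m ≠ m₂ := by
    rintro rfl
    exact p₂.ne hcm
  refine ⟨m, ⟨hm₁.1.trans hm.1, hm.2.trans hm₂.2⟩, hcm, ?_, ?_⟩
  · by_contra h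
    exact n₁ (le_antisymm (hmax ⟨⟨hm₁.1.trans hm.1, hm.2⟩, not_lt.1 h⟩) hm.1)
  · by_contra h
    exact n₂ (le_antisymm hm.2 (hmin ⟨⟨hm₁.1.trans hm.1, hm.2.trans hm₂.2⟩, not_lt.1 h⟩))

/-- A symmetric solution on the half interval with energy strictly between `r²` and `R²`, by
shooting from the midpoint. `G` and `F` are global extensions of `g` on `[0,1/2]` and `f` on
`[0,R]`. -/
theorem exists_half_solution {G F : ℝ → ℝ} {B N r R β : ℝ} {L : NNReal}
    (hG : Monotone G) (hG0 : ∀ t, 0 ≤ G t) (hGB : ∀ t, G t ≤ B)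
    (hF : LipschitzWith L F) (hFm : Monotone F) (hF0 : ∀ t, 0 ≤ F t) (hFN : ∀ t, F t ≤ N)
    (hr : 0 < r) (hrR : r < R) (hβ : β ∈ Ioo (0 : ℝ) (1 / 4))
    (hlow : F r ^ 2 * energy G < r ^ 2)
    (hhigh : R ^ 2 < 2 * β * (F (R * phi β) * flux G β) ^ 2) :
    ∃ u : ℝ → ℝ, Continuous u ∧ MonotoneOn u (Icc 0 (1 / 2)) ∧
      (∀ t ∈ Icc (0 : ℝ) (1 / 2), u t = ∫ s in (0 : ℝ)..t, flux (fun s => G s * F (u s)) s) ∧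
      (∀ t ∈ Icc (0 : ℝ) (1 / 2), u t ∈ Icc 0 R) ∧
      r ^ 2 < energy (fun s => G s * F (u s)) ∧ energy (fun s => G s * F (u s)) < R ^ 2 := by
  have hR : 0 < R := hr.trans hrR
  have hGabs : ∀ t, |G t| ≤ B := fun t => by
    rw [abs_of_nonneg (hG0 t)]
    exact hGB t
  have hB0 : 0 ≤ B := (hG0 0).trans (hGB 0)
  have hGi := intervalIntegrable_of_measurable_of_abs_le hG.measurable hGabs
  obtain ⟨u, hu, hueq, hum⟩ := exists_shooting_family hG.measurable hGabs hF
  let h : ℝ → ℝ → ℝ := fun m s => G s * F (u m s)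
  have hhi : ∀ m a b, IntervalIntegrable (h m) volume a b := fun m a b =>
    (hGi a b).mul_continuousOn (hF.continuous.comp (hu m)).continuousOn
  have hh0 : ∀ m s, 0 ≤ h m s := fun m s => mul_nonneg (hG0 s) (hF0 _)
  have hhB : ∀ m s, h m s ≤ B * N := fun m s => mul_le_mul (hGB s) (hFN _) (hF0 _) hB0
  have hfl : ∀ m, Continuous (flux (h m)) := fun m => continuous_flux (hhi m)
  have hfi : ∀ m a b, IntervalIntegrable (flux (h m)) volume a b := fun m a b =>
    (hfl m).intervalIntegrable a b
  have hc : ∀ m, ∀ t ∈ Icc (0 : ℝ) (1 / 2),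
      u m t = u m 0 + ∫ s in (0 : ℝ)..t, flux (h m) s := by
    intro m t ht
    rw [hueq m t ht, hueq m 0 (by simp)]
    have e : flux (flux (h m)) 0 = (∫ s in (0 : ℝ)..t, flux (h m) s) + flux (flux (h m)) t :=
      (intervalIntegral.integral_add_adjacent_intervals (hfi m _ _) (hfi m _ _)).symm
    change m - flux (flux (h m)) t = m - flux (flux (h m)) 0 + _
    rw [e]
    ring
  have hmid : ∀ m, u m (1 / 2) = m := fun m => by
    rw [hueq m (1 / 2) (by simp), flux, intervalIntegral.integral_same, sub_zero]
  have hmono : ∀ m, MonotoneOn (u m) (Icc 0 (1 / 2)) := by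
    intro m s hs t ht hst
    rw [hc m s hs, hc m t ht,
      ← intervalIntegral.integral_add_adjacent_intervals (hfi m 0 s) (hfi m s t)]
    have : 0 ≤ ∫ x in s..t, flux (h m) x := intervalIntegral.integral_nonneg hst fun x hx =>
      flux_nonneg (hx.2.trans ht.2) fun y _ => hh0 m y
    linarith
  have hhm : ∀ m, MonotoneOn (h m) (Icc 0 (1 / 2)) := fun m s hs t ht hst =>
    mul_le_mul (hG hst) (hFm (hmono m hs ht hst)) (hF0 _) (hG0 _)
  have hEcont : Continuous fun m => energy (h m) := by
    refine continuous_const.mul (intervalIntegral.continuous_of_dominated_interval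
      (bound := fun _ => (B * N / 2) ^ 2) (fun m => ((hfl m).pow 2).aestronglyMeasurable)
      (fun m => Filter.Eventually.of_forall fun t ht => ?_) (by simp)
      (Filter.Eventually.of_forall fun t ht => ?_))
    · rw [uIoc_of_le (by norm_num)] at ht
      have h1 : 0 ≤ flux (h m) t := flux_nonneg ht.2 fun s _ => hh0 m s
      have h2 : flux (h m) t ≤ ∫ s in t..(1 / 2 : ℝ), B * N :=
        intervalIntegral.integral_mono_on ht.2 (hhi m _ _) (by simp) fun s _ => hhB m s
      rw [intervalIntegral.integral_const, smul_eq_mul] at h2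
      have h3 : 0 ≤ B * N := (hh0 m 0).trans (hhB m 0)
      rw [Real.norm_eq_abs, abs_of_nonneg (sq_nonneg _)]
      exact pow_le_pow_left₀ h1 (by nlinarith [ht.1]) 2
    · refine Continuous.pow (intervalIntegral.continuous_of_dominated_interval
        (bound := fun _ => B * N)
        (fun m => (hG.measurable.mul (hF.continuous.comp (hu m)).measurable).aestronglyMeasurable)
        (fun m => Filter.Eventually.of_forall fun s _ => ?_) (by simp)
        (Filter.Eventually.of_forall fun s _ => ?_)) 2
      · change |h m s| ≤ B * N
        rw [abs_of_nonneg (hh0 m s)]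
        exact hhB m s
      · exact continuous_const.mul (hF.continuous.comp (hum s))
  -- Small solutions have small energy.
  have small : ∀ m, (∀ t ∈ Icc (0 : ℝ) (1 / 2), u m t ≤ r) → energy (h m) < r ^ 2 := by
    intro m hle
    refine lt_of_le_of_lt ?_ hlow
    rw [← energy_const_mul]
    refine energy_le_energy (hhi m) (fun a b => (hGi a b).const_mul _) (fun s _ => hh0 m s)
      fun s hs => ?_
    simp only [h]
    rw [mul_comm]
    exact mul_le_mul_of_nonneg_right (hFm (hle s hs)) (hG0 s)
  -- Large solutions have large energy.
  have large : ∀ m, R * phi β ≤ u m β → R ^ 2 < energy (h m) := by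
    intro m hle
    have hβ' : β ∈ Icc (0 : ℝ) (1 / 2) := ⟨hβ.1.le, by linarith [hβ.2]⟩
    refine hhigh.trans_le (le_trans ?_ (mul_sq_le_energy (hhi m) (fun s _ => hh0 m s) hβ'))
    have hfle : F (R * phi β) * flux G β ≤ flux (h m) β := by
      have : F (R * phi β) * flux G β = flux (fun s => F (R * phi β) * G s) β :=
        (intervalIntegral.integral_const_mul _ _).symm
      rw [this]
      refine flux_le_flux (fun a b => (hGi a b).const_mul _) (hhi m) hβ'.2 fun s hs => ?_
      simp only [h]
      rw [mul_comm]
      exact mul_le_mul_of_nonneg_left (hFm (hle.trans (hmono m hβ'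
        ⟨hβ'.1.trans hs.1, hs.2⟩ hs.1))) (hG0 s)
    have h0 : 0 ≤ F (R * phi β) * flux G β :=
      mul_nonneg (hF0 _) (flux_nonneg hβ'.2 fun s _ => hG0 s)
    have := hβ.1
    gcongr
  have htop : ∀ m, ∀ t ∈ Icc (0 : ℝ) (1 / 2), u m t ≤ m := fun m t ht => by
    have := hmono m ht (by simp) ht.2
    rwa [hmid] at this
  -- The shot with midpoint value `0` is nonpositive, hence has energy below `r²`. The shot with
  -- midpoint value `R` has energy at least `R²`: otherwise it would stay above
  -- `R / 2 ≥ R φ(β)` and `large` would apply.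
  obtain ⟨m, hm, hm0, hEr, hER⟩ := exists_zero_of_crossing hEcont (hum 0) hR.le
    (pow_lt_pow_left₀ hrR hr.le two_ne_zero)
    (small 0 fun t ht => (htop 0 t ht).trans hr.le) (by
      by_contra hlt
      rw [not_le] at hlt
      have h1 := integral_flux_le (hhi R)
      have h2 : Real.sqrt (energy (h R)) ≤ R := Real.sqrt_le_iff.2 ⟨hR.le, hlt.le⟩
      have h3 := hc R (1 / 2) (by simp)
      rw [hmid] at h3
      have h4 : u R 0 ≤ u R β :=
        hmono R (by simp) ⟨hβ.1.le, by linarith [hβ.2]⟩ hβ.1.le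
      have h5 : phi β ≤ 1 / 2 := by
        unfold phi
        nlinarith [hβ.1, hβ.2]
      have := large R (by nlinarith)
      linarith)
    (by
      -- At energy `r²` with `u(0) ≤ 0`, the shot would be at most `r / 2`, contradicting `small`.
      intro m _ hE
      by_contra hneg
      have h1 := integral_flux_le (hhi m)
      rw [hE, Real.sqrt_sq hr.le] at h1
      have h3 := hc m (1 / 2) (by simp)
      rw [hmid] at h3
      have := small m fun t ht => (htop m t ht).trans (by linarith)
      linarith)
    (by
      -- At energy `R²` with `u(0) ≥ 0`, Harnack gives `u(β) ≥ R φ(β)`, contradicting `large`.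
      intro m _ hE
      by_contra hpos
      have hβ' : β ∈ Icc (0 : ℝ) (1 / 2) := ⟨hβ.1.le, by linarith [hβ.2]⟩
      have h1 := phi_mul_sqrt_energy_le (hhi m) (fun s _ => hh0 m s) (hhm m) hβ'
      rw [hE, Real.sqrt_sq hR.le] at h1
      have h3 := hc m β hβ'
      have := large m (by linarith)
      linarith)
  refine ⟨u m, hu m, hmono m, fun t ht => ?_, fun t ht => ⟨?_, (htop m t ht).trans hm.2⟩,
    hEr, hER⟩
  · rw [hc m t ht, hm0, zero_add]
  · rw [← hm0]
    exact hmono m (by simp) ht ht.1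

/-! ### Reflection about the midpoint -/

theorem integral_eq_two_mul_of_symm {k : ℝ → ℝ} (hk : ∀ a b, IntervalIntegrable k volume a b)
    (hs : ∀ t, k (1 - t) = k t) :
    ∫ t in (0 : ℝ)..1, k t = 2 * ∫ t in (0 : ℝ)..(1 / 2), k t := by
  have e : ∫ t in (1 / 2 : ℝ)..1, k t = ∫ t in (0 : ℝ)..(1 / 2), k t := by
    have := intervalIntegral.integral_comp_sub_left (a := 0) (b := 1 / 2) k 1
    simp only [hs] at this
    rw [this]
    norm_num
  rw [← intervalIntegral.integral_add_adjacent_intervals (hk 0 (1 / 2)) (hk (1 / 2) 1), e]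
  ring

theorem flux_one_sub {h : ℝ → ℝ} (hs : ∀ t, h (1 - t) = h t) (t : ℝ) :
    flux h (1 - t) = -flux h t := by
  have := intervalIntegral.integral_comp_sub_left (a := 1 / 2) (b := t) h 1
  simp only [hs] at this
  rw [flux, flux, ← intervalIntegral.integral_symm, this]
  norm_num

theorem integral_flux_one_sub {h : ℝ → ℝ} (hh : ∀ a b, IntervalIntegrable h volume a b)
    (hs : ∀ t, h (1 - t) = h t) (t : ℝ) :
    ∫ s in (0 : ℝ)..(1 - t), flux h s = ∫ s in (0 : ℝ)..t, flux h s := by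
  have hfi : ∀ a b, IntervalIntegrable (flux h) volume a b := fun a b =>
    (continuous_flux hh).intervalIntegrable a b
  have := intervalIntegral.integral_comp_sub_left (a := t) (b := 1 - t) (flux h) 1
  simp only [flux_one_sub hs, intervalIntegral.integral_neg, sub_sub_cancel] at this
  rw [← intervalIntegral.integral_add_adjacent_intervals (hfi 0 t) (hfi t (1 - t))]
  linarith

/-- For `h` symmetric about `1/2`, the function `∫_0^t flux h` is the element of `H₀¹` that
represents the functional `v ↦ ∫ h v`, and its squared norm is `energy h`. -/
theorem solution_of_symm {h : ℝ → ℝ} (hh : ∀ a b, IntervalIntegrable h volume a b)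
    (hs : ∀ t, h (1 - t) = h t) :
    MemH01 (fun t => ∫ s in (0 : ℝ)..t, flux h s) ∧
      normH01 (fun t => ∫ s in (0 : ℝ)..t, flux h s) = Real.sqrt (energy h) ∧
      ∀ v, MemH01 v → innerH01 (fun t => ∫ s in (0 : ℝ)..t, flux h s) v =
        ∫ t in (0 : ℝ)..1, h t * v t := by
  have hq := continuous_flux hh
  have hw := hasWeakDerivL2_primitive hq
  refine ⟨⟨?_, by simp, ?_, _, hw⟩, ?_, fun v hv => innerH01_primitive (hh _ _) hq hv⟩
  · exact (intervalIntegral.continuous_primitive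
      (fun a b => hq.intervalIntegrable a b) 0).continuousOn
  · have := integral_flux_one_sub hh hs 0
    rwa [sub_zero, intervalIntegral.integral_same] at this
  · rw [normH01, innerH01_eq hw hw, energy]
    congr 1
    simp only [← sq]
    refine integral_eq_two_mul_of_symm (fun a b => (hq.pow 2).intervalIntegrable a b) fun t => ?_
    rw [flux_one_sub hs, neg_sq]

theorem integral_sq_symm_extend {G g : ℝ → ℝ} {B : ℝ} (hG : Measurable G) (hB : ∀ t, |G t| ≤ B)
    (hg : ∀ t ∈ Icc (0 : ℝ) 1, G (min t (1 - t)) = g t) :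
    ∫ t in (0 : ℝ)..1, g t ^ 2 = 2 * ∫ t in (0 : ℝ)..(1 / 2), G t ^ 2 := by
  have e1 : ∫ t in (0 : ℝ)..1, g t ^ 2 = ∫ t in (0 : ℝ)..1, G (min t (1 - t)) ^ 2 := by
    apply intervalIntegral.integral_congr
    intro t ht
    rw [uIcc_of_le zero_le_one] at ht
    simp only [hg t ht]
  rw [e1, integral_eq_two_mul_of_symm]
  · congr 1
    apply intervalIntegral.integral_congr
    intro t ht
    rw [uIcc_of_le (by norm_num)] at ht
    simp only [min_eq_left (by linarith [ht.2] : t ≤ 1 - t)]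
  · exact intervalIntegrable_of_measurable_of_abs_le (B := B ^ 2)
      ((hG.comp (by fun_prop)).pow_const 2)
      fun t => by rw [abs_pow]; exact pow_le_pow_left₀ (abs_nonneg _) (hB _) 2
  · intro t
    rw [sub_sub_cancel, min_comm]

end DirichletBVP


theorem theorem3p2 (f g : ℝ → ℝ) (r R β : ℝ)
    (hf : ContDiff ℝ 1 f)
    (hf_mono : MonotoneOn f (Ici 0))
    (hf_nonneg : ∀ t, 0 ≤ t → 0 ≤ f t)
    (hg_nonneg : ∀ t ∈ Icc (0 : ℝ) 1, 0 ≤ g t)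
    (hg_bdd : BddAbove (g '' Icc (0 : ℝ) 1))
    (hg_mono : MonotoneOn g (Icc (0 : ℝ) (1 / 2)))
    (hg_symm : ∀ t ∈ Icc (0 : ℝ) (1 / 2), g t = g (1 - t))
    (hr : 0 < r) (hrR : r < R) (hβ : β ∈ Ioo (0 : ℝ) (1 / 4))
    (h1 : CondH1 f g r R β)
    (h234 : CondH2 f R ∨ CondH3 f g r R β ∨ CondH4 f g r R β) :
    ∃ u ∈ coneK, IsSolution f g u ∧ r < normH01 u ∧ normH01 u < R := by
  have hR : 0 < R := hr.trans hrR
  have hpi := Real.pi_pos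
  obtain ⟨hA, hC, hfr, hfR⟩ := h1
  -- `G` extends `g` from `[0,1/2]`, and `F` extends `f` from `[0,R]`, by constants.
  have hhalf : (0 : ℝ) ≤ 1 / 2 := by norm_num
  let G : ℝ → ℝ := IccExtend hhalf ((Icc (0 : ℝ) (1 / 2)).domRestrict g)
  let F : ℝ → ℝ := IccExtend hR.le ((Icc (0 : ℝ) R).domRestrict f)
  have hGe : ∀ t ∈ Icc (0 : ℝ) (1 / 2), G t = g t := fun t ht => IccExtend_of_mem hhalf _ ht
  have hFe : ∀ t ∈ Icc (0 : ℝ) R, F t = f t := fun t ht => IccExtend_of_mem hR.le _ ht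
  have hGm : Monotone G := Monotone.IccExtend hhalf (monotoneOn_iff_monotone.1 hg_mono)
  have hFm : Monotone F := Monotone.IccExtend hR.le
    (monotoneOn_iff_monotone.1 (hf_mono.mono Icc_subset_Ici_self))
  have hG0 : ∀ t, 0 ≤ G t := fun t =>
    hg_nonneg _ ⟨(projIcc 0 (1 / 2) hhalf t).2.1,
      (projIcc 0 (1 / 2) hhalf t).2.2.trans (by norm_num)⟩
  have hGB : ∀ t, G t ≤ g (1 / 2) := fun t =>
    hg_mono (projIcc 0 (1 / 2) hhalf t).2 (by simp) (projIcc 0 (1 / 2) hhalf t).2.2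
  have hF0 : ∀ t, 0 ≤ F t := fun t => hf_nonneg _ (projIcc 0 R hR.le t).2.1
  have hFN : ∀ t, F t ≤ f R := fun t =>
    hf_mono (projIcc 0 R hR.le t).2.1 hR.le (projIcc 0 R hR.le t).2.2
  have hGabs : ∀ t, |G t| ≤ g (1 / 2) := fun t => by
    rw [abs_of_nonneg (hG0 t)]
    exact hGB t
  obtain ⟨L, hL⟩ := hf.contDiffOn.exists_lipschitzOnWith (s := Icc 0 R) one_ne_zero
    (convex_Icc _ _) isCompact_Icc
  have hFL : LipschitzWith (L * 1) F := hL.to_restrict.comp (LipschitzWith.projIcc hR.le)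
  have hGg : ∀ t ∈ Icc (0 : ℝ) 1, G (min t (1 - t)) = g t := by
    intro t ht
    rcases le_total t (1 / 2) with h | h
    · rw [min_eq_left (by linarith), hGe t ⟨ht.1, h⟩]
    · rw [min_eq_right (by linarith), hGe (1 - t) ⟨by linarith [ht.2], by linarith⟩,
        hg_symm (1 - t) ⟨by linarith [ht.2], by linarith⟩, sub_sub_cancel]
  have hlow : F r ^ 2 * energy G < r ^ 2 := by
    have hw := energy_le_of_abs_le hGm.measurable hGabs
    rw [← integral_sq_symm_extend hGm.measurable hGabs hGg] at hw
    have hA2 : constA g ^ 2 = ∫ t in (0 : ℝ)..1, g t ^ 2 :=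
      Real.sq_sqrt (intervalIntegral.integral_nonneg zero_le_one fun _ _ => sq_nonneg _)
    rw [← hA2] at hw
    rw [hFe r ⟨hr.le, hrR.le⟩]
    -- Cleared of denominators, the hypothesis at `r` reads `f r * Ã < π r`.
    rw [div_lt_div_iff₀ hr hA] at hfr
    have hfr0 := hf_nonneg r hr.le
    have h2 : (f r * constA g) ^ 2 < (Real.pi * r) ^ 2 :=
      pow_lt_pow_left₀ hfr (by positivity) two_ne_zero
    have h3 : Real.pi ^ 2 * (f r ^ 2 * energy G) ≤ (f r * constA g) ^ 2 := by
      rw [mul_pow, mul_left_comm]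
      gcongr
    refine lt_of_mul_lt_mul_left (h3.trans_lt (h2.trans_eq (mul_pow _ _ _))) (by positivity)
  have hφ : 0 < phi β := mul_pos hβ.1 (by linarith [hβ.2])
  have hφ1 : phi β ≤ 1 := by
    unfold phi
    nlinarith [hβ.1, hβ.2]
  have hhigh : R ^ 2 < 2 * β * (F (R * phi β) * flux G β) ^ 2 := by
    have hCe : flux G β = constC g β := by
      apply intervalIntegral.integral_congr
      intro t ht
      rw [uIcc_of_le (by linarith [hβ.2])] at ht
      exact hGe t ⟨hβ.1.le.trans ht.1, ht.2⟩
    rw [hCe, hFe (R * phi β) ⟨by positivity, by nlinarith⟩]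
    -- Here `R < 2 φ(β) x` with `x = f(R φ(β)) C̃`, and `(2 φ(β))² ≤ 2 β`.
    rw [gt_iff_lt, div_lt_div_iff₀ (by positivity) hR, one_mul] at hfR
    set x := f (R * phi β) * constC g β with hx
    have h2 : R ^ 2 < (2 * phi β * x) ^ 2 := by
      refine pow_lt_pow_left₀ (hfR.trans_eq ?_) hR.le two_ne_zero
      rw [hx]
      ring
    refine h2.trans_le ?_
    rw [mul_pow]
    refine mul_le_mul_of_nonneg_right ?_ (sq_nonneg _)
    have h3 : (1 - 2 * β) ^ 2 ≤ 1 := by nlinarith [hβ.1, hβ.2]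
    have h4 : 2 * β * (1 - 2 * β) ^ 2 ≤ 1 := by nlinarith [hβ.1, hβ.2]
    calc (2 * phi β) ^ 2 = 2 * β * (2 * β * (1 - 2 * β) ^ 2) := by
          unfold phi
          ring
      _ ≤ 2 * β := mul_le_of_le_one_right (by linarith [hβ.1]) h4
  obtain ⟨u, hu, humono, hueq, huR, hEr, hER⟩ := exists_half_solution hGm hG0 hGB hFL hFm hF0
    hFN hr hrR hβ hlow hhigh
  -- `h` is the reflection about `1/2` of the right-hand side `k` on `[0,1/2]`.
  let h : ℝ → ℝ := fun s => G (min s (1 - s)) * F (u (min s (1 - s)))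
  let k : ℝ → ℝ := fun s => G s * F (u s)
  have hhk : ∀ s ∈ Icc (0 : ℝ) (1 / 2), h s = k s := fun s hs => by
    simp only [h, k, min_eq_left (by linarith [hs.2] : s ≤ 1 - s)]
  have hmeas : Measurable fun s : ℝ => min s (1 - s) := by fun_prop
  have hGi := intervalIntegrable_of_measurable_of_abs_le hGm.measurable hGabs
  have hki : ∀ a b, IntervalIntegrable k volume a b := fun a b =>
    (hGi a b).mul_continuousOn (hFL.continuous.comp hu).continuousOn
  have hhi : ∀ a b, IntervalIntegrable h volume a b := fun a b =>
    (intervalIntegrable_of_measurable_of_abs_le (hGm.measurable.comp hmeas)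
      (fun t => hGabs _) a b).mul_continuousOn
      (hFL.continuous.comp (hu.comp (by fun_prop))).continuousOn
  have hsymm : ∀ t, h (1 - t) = h t := fun t => by
    simp only [h, sub_sub_cancel, min_comm]
  have hflux : ∀ t ∈ Icc (0 : ℝ) (1 / 2), flux h t = flux k t := by
    intro t ht
    apply intervalIntegral.integral_congr
    intro s hs
    rw [uIcc_of_le ht.2] at hs
    exact hhk s ⟨ht.1.trans hs.1, hs.2⟩
  have henergy : energy h = energy k := by
    unfold energy
    congr 1
    apply intervalIntegral.integral_congr
    intro s hs
    rw [uIcc_of_le hhalf] at hs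
    simp only [hflux s hs]
  obtain ⟨hmem, hnorm, hinner⟩ := solution_of_symm hhi hsymm
  set U : ℝ → ℝ := fun t => ∫ s in (0 : ℝ)..t, flux h s with hU
  have hUu : ∀ t ∈ Icc (0 : ℝ) (1 / 2), U t = u t := by
    intro t ht
    rw [hueq t ht]
    apply intervalIntegral.integral_congr
    intro s hs
    rw [uIcc_of_le ht.1] at hs
    exact hflux s ⟨hs.1, hs.2.trans ht.2⟩
  have hUsymm : ∀ t, U (1 - t) = U t := integral_flux_one_sub hhi hsymm
  have hUmin : ∀ t ∈ Icc (0 : ℝ) 1, u (min t (1 - t)) = U t := by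
    intro t ht
    rcases le_total t (1 / 2) with h | h
    · rw [min_eq_left (by linarith), hUu t ⟨ht.1, h⟩]
    · rw [min_eq_right (by linarith), ← hUu (1 - t) ⟨by linarith [ht.2], by linarith⟩, hUsymm]
  rw [henergy] at hnorm
  refine ⟨U, ⟨hmem, ?_, fun t ht => ⟨(hUsymm t).symm, ?_⟩⟩, ⟨hmem, fun v hv => ?_⟩, ?_, ?_⟩
  · intro s hs t ht hst
    rw [hUu s hs, hUu t ht]
    exact humono hs ht hst
  · rw [hnorm, hUu t ht, hueq t ht]
    exact phi_mul_sqrt_energy_le hki (fun s _ => mul_nonneg (hG0 _) (hF0 _))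
      (fun s hs t ht hst => mul_le_mul (hGm hst) (hFm (humono hs ht hst)) (hF0 _) (hG0 _)) ht
  · rw [hinner v hv]
    apply intervalIntegral.integral_congr
    intro t ht
    rw [uIcc_of_le zero_le_one] at ht
    have hmin : min t (1 - t) ∈ Icc (0 : ℝ) (1 / 2) := by
      refine ⟨le_min ht.1 (by linarith [ht.2]), ?_⟩
      rcases le_total t (1 / 2) with h | h
      · exact (min_le_left _ _).trans h
      · exact (min_le_right _ _).trans (by linarith)
    simp only [h]
    rw [hFe _ (huR _ hmin), hGg t ht, hUmin t ht]
  · rw [hnorm]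
    exact Real.lt_sqrt_of_sq_lt hEr
  · rw [hnorm]
    exact (Real.sqrt_lt' hR).2 hER
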